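/- Let $\Bbbk$ be a field of characteristic zero, $d\ge 0$, $m\ge 1$, $\mathbf n=(n_1,\dots,n_d)\in\mathbb N^d$, $\mathbf r=(r_1,\dots,r_m)$ with all $r_k\ge 2$, $R=r_1\cdots r_m$; write $[\mathbf n]=[n_1]\times\cdots\times[n_d]$ and $\odot$ for the entrywise (Hadamard) product of tensors in $\Bbbk^{n_1\times\cdots\times n_d}$. Let $\mathcal S^*$ be the group, under $\odot$, of rank-$1$ tensors with all entries nonzero. *Definitions.* A *CPD* of $T$ is a decomposition of $T$ as a sum of rank-$1$ tensors of minimal length $\operatorname{rank}(T)$; $T$ is *$R$-identifiable* if it has rank $R$ and a unique CPD up to reordering. An *$\mathbf r$-HHD* of $T$ is a family of rank-$1$ tensors $(A_{k,l})_{k\in[m],\,l\in[r_k]}$ with $T=\bigodot_{k=1}^m\sum_{l=1}^{r_k}A_{k,l}$. The *essential* HHDs of $T$ are the classes of $\mathbf r$-HHDs of $T$ modulo reordering the terms inside each factor, permuting factors of equal length, and replacing $A_{k,l}$ by $D_k\odot A_{k,l}$ with $D_1,\dots,D_m\in\mathcal S^*$ whose Hadamard product is the all-ones tensor. $T$ is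 *$\mathbf r$-identifiable* if it has exactly one essential HHD. For a bijection $\rho:[R]\to[\mathbf r']$ (where $\mathbf r'$ is any shape with all $r'_k\ge2$ and $\prod_k r'_k=R$) let $\mathcal A^\rho$ be the set of $\mathbf a\in\Bbbk^R$ such that the tensor with entry $a_i$ at position $\rho(i)$ has rank $1$. Then $\rho$ is a *maximal rank-$1$ permutation* of $\mathbf a$ if $\mathbf a\in\mathcal A^\rho$ and $\mathbf a\notin\mathcal A^{\rho'}$ whenever $\rho'$ (of any such shape) satisfies $\mathcal A^{\rho'}\subsetneq\mathcal A^\rho$. It is the *unique* one if every maximal rank-$1$ permutation $\rho'$ of $\mathbf a$ (of any such shape $\mathbf r'$) has the form $\sigma\circ\rho$, where the bijection $\sigma:[\mathbf r]\to[\mathbf r']$ maps rank-$1$ tensors to rank-$1$ tensors. *Algorithm* (input $T$, with a chosen index $\mathbf p\in[\mathbf n]$). 1. Compute a CPD $T=B_1+\cdots+B_R$. 2. Compute a maximal rank-$1$ permutation $\rho:[R]\to[\mathbf r]$ of $\mathbf b_{\mathbf p}=((B_1)_{\mathbf p},\dots,(B_R)_{\mathbf p})$. 3. Form the tensor $H$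 with $H_{\rho(s),:}=B_s$ for $s\in[R]$, and choose a base index $\mathbf i\in[\mathbf r]$ with $H_{\mathbf i,:}\in\mathcal S^*$. 4. For each $\mathbf j\in[\mathbf n]$ compute the interpolatory decomposition of $H_{:,\mathbf j}$ at $\mathbf i$: with $\mathbf i[k\to l]$ denoting $\mathbf i$ with its $k$th entry replaced by $l$, put $(A_{1,l})_{\mathbf j}=H_{\mathbf i[1\to l],\mathbf j}$ and $(A_{k,l})_{\mathbf j}=H_{\mathbf i[k\to l],\mathbf j}/H_{\mathbf i,\mathbf j}$ for $k\ge2$. Return $(A_{k,l})$. **Proposition.** Suppose that $T\in\Bbbk^{n_1\times\cdots\times n_d}$ is $\mathbf r$-identifiable and $R$-identifiable, that some term of its CPD lies in $\mathcal S^*$, and that $\mathbf p\in[\mathbf n]$ is such that the vector $\mathbf b_{\mathbf p}$ of $\mathbf p$-entries of the terms of the CPD has distinct entries and a unique maximal rank-$1$ permutation, which is of shape $\mathbf r$. Then the algorithm recovers the essential HHD of $T$: whatever CPD is returned in step 1, a permutation $\rho$ as in step 2 exists; for every such $\rho$ a base index as in step 3 exists; and for each such choice of $\rho$ and $\mathbf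 i$ the output $(A_{k,l})$ satisfies $H_{\mathbf q,:}=A_{1,q_1}\odot\cdots\odot A_{m,q_m}$ for all $\mathbf q\in[\mathbf r]$, is an $\mathbf r$-HHD of $T$, and represents the unique essential HHD of $T$. -/

import Mathlib

open scoped BigOperators

/-- The multi-indices `[n] = [n_1] × ⋯ × [n_d]`. -/
abbrev MultiIndex {d : ℕ} (n : Fin d → ℕ) : Type := ∀ i, Fin (n i)

/-- Tensors in `K^{n_1 × ⋯ × n_d}`, in coordinates. The pointwise product of this function space
is the Hadamard product, and `1` is the all-ones tensor. -/
abbrev Tensor (K : Type*) {d : ℕ} (n : Fin d → ℕ) : Type _ := MultiIndex n → K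

/-- The tensor product `v_1 ⊗ ⋯ ⊗ v_d` of vectors. -/
def outer {K : Type*} [Field K] {d : ℕ} {n : Fin d → ℕ} (v : ∀ i, Fin (n i) → K) : Tensor K n :=
  fun j => ∏ i, v i (j i)

/-- Tensors of rank exactly one: the nonzero tensors `c • (v_1 ⊗ ⋯ ⊗ v_d)`.
(The scalar `c` only matters for `d = 0`.) -/
def IsRankOne {K : Type*} [Field K] {d : ℕ} {n : Fin d → ℕ} (T : Tensor K n) : Prop :=
  T ≠ 0 ∧ ∃ (c : K) (v : ∀ i, Fin (n i) → K), T = c • outer v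

/-- The group `S^*` of rank-one tensors all of whose entries are nonzero. -/
def IsRankOneUnit {K : Type*} [Field K] {d : ℕ} {n : Fin d → ℕ} (T : Tensor K n) : Prop :=
  (∀ j, T j ≠ 0) ∧ ∃ (c : K) (v : ∀ i, Fin (n i) → K), T = c • outer v

/-- `T = B_1 + ⋯ + B_s` is an (ordered) Hitchcock decomposition of length `s`. -/
def IsHitchcock {K : Type*} [Field K] {d : ℕ} {n : Fin d → ℕ} {s : ℕ}
    (T : Tensor K n) (B : Fin s → Tensor K n) : Prop :=
  (∀ i, IsRankOne (B i)) ∧ T = ∑ i, B i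

/-- The tensor rank. -/
noncomputable def tensorRank {K : Type*} [Field K] {d : ℕ} {n : Fin d → ℕ} (T : Tensor K n) : ℕ :=
  sInf {s : ℕ | ∃ B : Fin s → Tensor K n, IsHitchcock T B}

/-- `B` lists the terms of a CPD of `T`, that is, of a Hitchcock decomposition of minimum length. -/
def IsCPD {K : Type*} [Field K] {d : ℕ} {n : Fin d → ℕ} {s : ℕ}
    (T : Tensor K n) (B : Fin s → Tensor K n) : Prop :=
  tensorRank T = s ∧ IsHitchcock T B

/-- The set of Hitchcock decompositions of `T` of length `s`, up to reordering the terms. -/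
def decompositions {K : Type*} [Field K] {d : ℕ} {n : Fin d → ℕ} (s : ℕ) (T : Tensor K n) :
    Set (Multiset (Tensor K n)) :=
  {M | ∃ B : Fin s → Tensor K n, IsHitchcock T B ∧ M = Finset.univ.val.map B}

/-- `T` has rank `s` and exactly one CPD. -/
def IsIdentifiable {K : Type*} [Field K] {d : ℕ} {n : Fin d → ℕ} (s : ℕ) (T : Tensor K n) : Prop :=
  tensorRank T = s ∧ ∃ M, decompositions s T = {M}

/-- `A` is an ordered `r`-Hadamard–Hitchcock decomposition of `T`: the tensors `A k i` have rank
one and `T` is the Hadamard product over `k` of the sums `∑ i, A k i`. -/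
def IsHHD {K : Type*} [Field K] {d m : ℕ} {n : Fin d → ℕ} {r : Fin m → ℕ}
    (T : Tensor K n) (A : ∀ k, Fin (r k) → Tensor K n) : Prop :=
  (∀ k i, IsRankOne (A k i)) ∧ T = ∏ k, ∑ i, A k i

/-- Two ordered HHDs are essentially the same if they differ by
a permutation `ψ` of Hadamard factors of equal length, permutations `π k` of the terms inside the
factors, and Hadamard multiplication of the factors by elements `D k` of `S^*` whose Hadamard
product is the all-ones tensor. (A bijection `π k` exists precisely if `r k = r (ψ k)`.) -/
def EssentiallyEqual {K : Type*} [Field K] {d m : ℕ} {n : Fin d → ℕ} {r : Fin m → ℕ}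
    (A A' : ∀ k, Fin (r k) → Tensor K n) : Prop :=
  ∃ (ψ : Equiv.Perm (Fin m)) (π : ∀ k, Fin (r k) ≃ Fin (r (ψ k))) (D : Fin m → Tensor K n),
    (∀ k, IsRankOneUnit (D k)) ∧ ∏ k, D k = 1 ∧ ∀ k i, A' k i = D k * A (ψ k) (π k i)

theorem IsRankOneUnit.one {K : Type*} [Field K] {d : ℕ} {n : Fin d → ℕ} :
    IsRankOneUnit (1 : Tensor K n) :=
  ⟨fun _ => one_ne_zero, 1, fun _ _ => 1, by ext j; simp [outer]⟩

theorem IsRankOneUnit.mul {K : Type*} [Field K] {d : ℕ} {n : Fin d → ℕ} {S T : Tensor K n}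
    (hS : IsRankOneUnit S) (hT : IsRankOneUnit T) : IsRankOneUnit (S * T) := by
  obtain ⟨hS0, c, v, rfl⟩ := hS
  obtain ⟨hT0, c', v', rfl⟩ := hT
  refine ⟨fun j => mul_ne_zero (hS0 j) (hT0 j), c * c', fun i x => v i x * v' i x, ?_⟩
  ext j
  simp only [outer, Pi.mul_apply, Pi.smul_apply, smul_eq_mul, Finset.prod_mul_distrib]
  ring

theorem IsRankOneUnit.inv {K : Type*} [Field K] {d : ℕ} {n : Fin d → ℕ} {S : Tensor K n}
    (hS : IsRankOneUnit S) : IsRankOneUnit S⁻¹ := by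
  obtain ⟨hS0, c, v, rfl⟩ := hS
  refine ⟨fun j => inv_ne_zero (hS0 j), c⁻¹, fun i x => (v i x)⁻¹, ?_⟩
  ext j
  simp only [outer, Pi.inv_apply, Pi.smul_apply, smul_eq_mul, Finset.prod_inv_distrib, mul_inv]

theorem EssentiallyEqual.refl {K : Type*} [Field K] {d m : ℕ} {n : Fin d → ℕ} {r : Fin m → ℕ}
    (A : ∀ k, Fin (r k) → Tensor K n) : EssentiallyEqual A A :=
  ⟨Equiv.refl _, fun _ => Equiv.refl _, fun _ => 1, fun _ => IsRankOneUnit.one, by simp,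
    fun k i => (one_mul (A k i)).symm⟩

theorem EssentiallyEqual.symm {K : Type*} [Field K] {d m : ℕ} {n : Fin d → ℕ} {r : Fin m → ℕ}
    {A A' : ∀ k, Fin (r k) → Tensor K n} (h : EssentiallyEqual A A') : EssentiallyEqual A' A := by
  obtain ⟨ψ, π, D, hD, hprod, hA⟩ := h
  have key : ∀ k' k, ψ k' = k → ∃ e : Fin (r k) ≃ Fin (r k'),
      ∀ i, A k i = (D k')⁻¹ * A' k' (e i) := by
    rintro k' k rfl
    refine ⟨(π k').symm, fun i => ?_⟩
    rw [hA]
    ext j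
    have := (hD k').1 j
    simp [this]
  choose e he using fun k => key (ψ.symm k) k (by simp)
  refine ⟨ψ.symm, e, fun k => (D (ψ.symm k))⁻¹, fun k => (hD _).inv, ?_, he⟩
  rw [Equiv.prod_comp ψ.symm (fun k => (D k)⁻¹), Finset.prod_inv_distrib, hprod, inv_one]

theorem EssentiallyEqual.trans {K : Type*} [Field K] {d m : ℕ} {n : Fin d → ℕ} {r : Fin m → ℕ}
    {A A' A'' : ∀ k, Fin (r k) → Tensor K n} (h : EssentiallyEqual A A')
    (h' : EssentiallyEqual A' A'') : EssentiallyEqual A A'' := by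
  obtain ⟨ψ, π, D, hD, hprod, hA⟩ := h
  obtain ⟨ψ', π', D', hD', hprod', hA'⟩ := h'
  refine ⟨ψ'.trans ψ, fun k => (π' k).trans (π (ψ' k)), fun k => D' k * D (ψ' k),
    fun k => (hD' k).mul (hD _), ?_, fun k i => ?_⟩
  · rw [Finset.prod_mul_distrib, Equiv.prod_comp ψ' D, hprod, hprod', one_mul]
  · rw [hA', hA, mul_assoc]; rfl

/-- Essential equality as an equivalence relation on the ordered `r`-HHDs of `T`. -/
def essentialSetoid {K : Type*} [Field K] {d m : ℕ} {n : Fin d → ℕ} (r : Fin m → ℕ)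
    (T : Tensor K n) : Setoid {A : ∀ k, Fin (r k) → Tensor K n // IsHHD T A} where
  r A A' := EssentiallyEqual A.1 A'.1
  iseqv := ⟨fun A => EssentiallyEqual.refl A.1, fun h => h.symm, fun h h' => h.trans h'⟩

/-- The set of essential `r`-HHDs of `T`. -/
def EssentialHHD {K : Type*} [Field K] {d m : ℕ} {n : Fin d → ℕ} (r : Fin m → ℕ)
    (T : Tensor K n) : Type _ := Quotient (essentialSetoid r T)

/-- The essential HHD given by an ordered HHD. -/
def EssentialHHD.mk {K : Type*} [Field K] {d m : ℕ} {n : Fin d → ℕ} {r : Fin m → ℕ}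
    {T : Tensor K n} (A : ∀ k, Fin (r k) → Tensor K n) (h : IsHHD T A) : EssentialHHD r T :=
  Quotient.mk (essentialSetoid r T) ⟨A, h⟩

/-- `T` is `r`-identifiable: it has exactly one essential `r`-HHD. -/
def IsHHDIdentifiable {K : Type*} [Field K] {d m : ℕ} {n : Fin d → ℕ} (r : Fin m → ℕ)
    (T : Tensor K n) : Prop :=
  ∃ E : EssentialHHD r T, ∀ E' : EssentialHHD r T, E' = E

/-- The set `A^ρ` of the vectors `a` that are admissible for the bijection `ρ : [R] → [r]`, which
means that `ρ` is a rank-1 permutation of `a`: the tensor with entry `a i` at position `ρ i` has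
rank one. -/
def admissible (K : Type*) [Field K] {R m : ℕ} {r : Fin m → ℕ} (ρ : Fin R ≃ MultiIndex r) :
    Set (Fin R → K) :=
  {a | IsRankOne (n := r) (fun q => a (ρ.symm q))}

/-- `σ : [r] → [r']` is a rank-1 preserver permutation. -/
def IsRankOnePreserver (K : Type*) [Field K] {m m' : ℕ} {r : Fin m → ℕ} {r' : Fin m' → ℕ}
    (σ : MultiIndex r ≃ MultiIndex r') : Prop :=
  ∀ X : Tensor K r, IsRankOne X → IsRankOne (n := r') (fun q => X (σ.symm q))

/-- `ρ` is a maximal rank-1 permutation of `a`: it is a rank-1 permutation of `a`, and `a` is not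
admissible for any `ρ'`, onto multi-indices of any shape `r'` with entries at least `2`, whose
set of admissible vectors is strictly smaller. -/
def IsMaximalRankOnePerm {K : Type*} [Field K] {R m : ℕ} {r : Fin m → ℕ}
    (ρ : Fin R ≃ MultiIndex r) (a : Fin R → K) : Prop :=
  a ∈ admissible K ρ ∧
    ∀ (m' : ℕ) (r' : Fin m' → ℕ), (∀ k, 2 ≤ r' k) → ∀ ρ' : Fin R ≃ MultiIndex r',
      admissible K ρ' ⊂ admissible K ρ → a ∉ admissible K ρ'

/-- `a` has a maximal rank-1 permutation onto `[r]`, and this is its only maximal rank-1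
permutation, of whatever shape, up to rank-1 preserver permutations. -/
def HasUniqueMaximalRankOnePerm {K : Type*} [Field K] {R m : ℕ} (r : Fin m → ℕ)
    (a : Fin R → K) : Prop :=
  ∃ ρ : Fin R ≃ MultiIndex r, IsMaximalRankOnePerm ρ a ∧
    ∀ (m' : ℕ) (r' : Fin m' → ℕ), (∀ k, 2 ≤ r' k) → ∀ ρ' : Fin R ≃ MultiIndex r',
      IsMaximalRankOnePerm ρ' a → IsRankOnePreserver K (ρ.symm.trans ρ')

/-- The vector `b_p = ((B_1)_p, …, (B_R)_p)`. -/
def entryVector {K : Type*} [Field K] {d R : ℕ} {n : Fin d → ℕ} (B : Fin R → Tensor K n)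
    (p : MultiIndex n) : Fin R → K :=
  fun s => B s p

/-- The Hadamard–Hitchcock tensor of an ordered HHD. -/
def hht {K : Type*} [Field K] {d m : ℕ} {n : Fin d → ℕ} {r : Fin m → ℕ}
    (A : ∀ k, Fin (r k) → Tensor K n) : MultiIndex r → Tensor K n :=
  fun q => ∏ k, A k (q k)

/-- The tensor `H` with `H_{ρ(s),:} = B_s`. -/
def stack {K : Type*} [Field K] {d m R : ℕ} {n : Fin d → ℕ} {r : Fin m → ℕ}
    (ρ : Fin R ≃ MultiIndex r) (B : Fin R → Tensor K n) : MultiIndex r → Tensor K n :=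
  fun q => B (ρ.symm q)

/-- The interpolatory decomposition of a rank-one tensor `X` at an index `i` with `X i ≠ 0`:
the vectors `a_1, …, a_m` with `X = a_1 ⊗ ⋯ ⊗ a_m` and `(a_k)_{i_k} = 1` for all `k` but the first
one, read off from the entries of `X` on the `i`-cross. -/
noncomputable def interpolate {K : Type*} [Field K] {m : ℕ} [NeZero m] {r : Fin m → ℕ}
    (i : MultiIndex r) (X : Tensor K r) : ∀ k, Fin (r k) → K :=
  fun k l => if k = 0 then X (Function.update i k l) else X (Function.update i k l) / X i

/-- `interpolate i` inverts the parametrization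
`(a_1, …, a_m) ↦ a_1 ⊗ ⋯ ⊗ a_m`, `(a_k)_{i_k} = 1` for all `k` but the first. -/
theorem interpolate_outer {K : Type*} [Field K] {m : ℕ} [NeZero m] {r : Fin m → ℕ}
    (i : MultiIndex r) (a : ∀ k, Fin (r k) → K) (h0 : a 0 (i 0) ≠ 0)
    (h1 : ∀ k, k ≠ 0 → a k (i k) = 1) : interpolate i (outer a) = a := by
  have hX : outer a i = a 0 (i 0) := by
    unfold outer
    exact Finset.prod_eq_single 0 (fun k _ hk => h1 k hk) (by simp)
  funext k l
  unfold interpolate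
  split_ifs with hk
  · subst hk
    unfold outer
    rw [Finset.prod_eq_single 0 (fun k _ hk => by simp [Function.update_of_ne hk, h1 k hk])
      (by simp)]
    simp
  · rw [hX, div_eq_iff h0]
    unfold outer
    rw [← Finset.mul_prod_erase _ _ (Finset.mem_univ k)]
    rw [Finset.prod_eq_single_of_mem (0 : Fin m) (by simp [Ne.symm hk])]
    · simp [Function.update_of_ne (Ne.symm hk)]
    · intro b hb hb0
      rw [Function.update_of_ne (Finset.ne_of_mem_erase hb), h1 b hb0]

/-- The steps of the algorithm after the CPD `B` and the rank-1 permutation `ρ` are computed: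
arrange the terms in the tensor `H`, and fill in the entries of the output tensors `A_{k l}`, for
each `j ∈ [n]`, from the interpolatory decomposition of `H_{:,j}` at the base index `i`. -/
noncomputable def decouple {K : Type*} [Field K] {d m R : ℕ} [NeZero m] {n : Fin d → ℕ}
    {r : Fin m → ℕ} (ρ : Fin R ≃ MultiIndex r) (B : Fin R → Tensor K n) (i : MultiIndex r) :
    ∀ k, Fin (r k) → Tensor K n :=
  fun k l j => interpolate i (fun q => stack ρ B q j) k l

/-!
Expanding the product of sums in an HHD `A` of `T` writes `T` as a sum of `R` elementary tensors
`hht A q`. Since `T` has rank `R`, none of them vanishes, so by `R`-identifiability they are the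
terms of the CPD, arranged along some bijection `ρ₀`. Every slice `(hht A)_{:,j}` is an outer
product, hence `ρ₀` is a rank-one permutation of every `b_j`.

It remains to replace `ρ₀` by the permutation `ρ` computed from the single slice `b_p`. Below `ρ₀`
there is a maximal rank-one permutation of `b_p`, so uniqueness at `p` puts the admissible set of
the unique maximal permutation inside that of `ρ₀`. Both have shape `r`, and permutations of `[r]`
have finite order, so the two admissible sets agree. The same applies to `ρ`, so every slice of
the stacked tensor has rank one and is recovered by interpolation.
-/

theorem exists_perm_eq_comp_of_map_univ_eq {ι α : Type*} [Fintype ι] {f g : ι → α}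
    (h : Finset.univ.val.map f = Finset.univ.val.map g) : ∃ τ : Equiv.Perm ι, f = g ∘ τ := by
  classical
  have fiber_card (x : α) : Fintype.card {s // f s = x} = Fintype.card {s // g s = x} := by
    have hcount := congrArg (Multiset.count x) h
    simp only [Multiset.count_map, eq_comm (a := x)] at hcount
    simp only [Fintype.card_subtype]
    exact hcount
  exact ⟨Equiv.ofFiberEquiv fun x => Fintype.equivOfCardEq (fiber_card x),
    funext fun s => (Equiv.ofFiberEquiv_map _ s).symm⟩

section Elementary

variable {K : Type*} [Field K] {d : ℕ} {n : Fin d → ℕ}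

/-- The elementary tensors `c • (v_1 ⊗ ⋯ ⊗ v_d)`, that is, the tensors of rank at most one. They
are closed under Hadamard products; `IsRankOne` singles out the nonzero ones. -/
def elementaryTensors (K : Type*) [Field K] {d : ℕ} (n : Fin d → ℕ) : Submonoid (Tensor K n) where
  carrier := {T | ∃ (c : K) (v : ∀ i, Fin (n i) → K), T = c • outer v}
  one_mem' := IsRankOneUnit.one.2
  mul_mem' := by
    rintro _ _ ⟨c, v, rfl⟩ ⟨c', v', rfl⟩
    refine ⟨c * c', fun i x => v i x * v' i x, ?_⟩
    ext j
    simp only [outer, Pi.mul_apply, Pi.smul_apply, smul_eq_mul, Finset.prod_mul_distrib]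
    ring

theorem IsRankOne.div {X D : Tensor K n} (hX : IsRankOne X) (hD : IsRankOneUnit D) :
    IsRankOne (X / D) := by
  obtain ⟨j, hj⟩ := Function.ne_iff.1 hX.1
  refine ⟨Function.ne_iff.2 ⟨j, div_ne_zero hj (hD.1 j)⟩, ?_⟩
  rw [div_eq_mul_inv]
  exact (elementaryTensors K n).mul_mem hX.2 hD.inv.2

theorem tensorRank_sum_le_card {ι : Type*} (s : Finset ι) {X : ι → Tensor K n}
    (hX : ∀ q ∈ s, IsRankOne (X q)) : tensorRank (∑ q ∈ s, X q) ≤ s.card := by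
  refine Nat.sInf_le ⟨fun t => X (s.equivFin.symm t), fun t => hX _ (s.equivFin.symm t).2, ?_⟩
  rw [Equiv.sum_comp s.equivFin.symm fun q : s => X q, Finset.sum_coe_sort]

theorem isRankOne_of_card_le_tensorRank_sum {ι : Type*} [Fintype ι] {X : ι → Tensor K n}
    (hX : ∀ q, X q ∈ elementaryTensors K n) (hrank : Fintype.card ι ≤ tensorRank (∑ q, X q))
    (q : ι) : IsRankOne (X q) := by
  classical
  refine ⟨fun hq => hrank.not_gt ?_, hX q⟩
  calc
    tensorRank (∑ q, X q) = tensorRank (∑ q with X q ≠ 0, X q) := by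
      rw [Finset.sum_filter_ne_zero]
    _ ≤ (Finset.univ.filter fun q => X q ≠ 0).card :=
      tensorRank_sum_le_card _ fun q hq => ⟨(Finset.mem_filter.1 hq).2, hX q⟩
    _ < Fintype.card ι := Finset.card_lt_univ_of_notMem (x := q) (by simp [hq])

theorem IsIdentifiable.exists_perm_eq_comp {s : ℕ} {T : Tensor K n} (h : IsIdentifiable s T)
    {B C : Fin s → Tensor K n} (hB : IsHitchcock T B) (hC : IsHitchcock T C) :
    ∃ τ : Equiv.Perm (Fin s), B = C ∘ τ := by
  obtain ⟨M, hM⟩ := h.2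
  have hsub : (decompositions s T).Subsingleton := hM ▸ Set.subsingleton_singleton
  exact exists_perm_eq_comp_of_map_univ_eq (hsub ⟨B, hB, rfl⟩ ⟨C, hC, rfl⟩)

end Elementary

section Interpolation

variable {K : Type*} [Field K] {m : ℕ} [NeZero m] {r : Fin m → ℕ}

theorem exists_outer_eq_of_apply_ne_zero {X : Tensor K r} (hX : X ∈ elementaryTensors K r)
    {i : MultiIndex r} (hi : X i ≠ 0) :
    ∃ a : ∀ k, Fin (r k) → K, a 0 (i 0) ≠ 0 ∧ (∀ k, k ≠ 0 → a k (i k) = 1) ∧ outer a = X := by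
  obtain ⟨c, v, rfl⟩ := hX
  have hprod : ∏ k, v k (i k) ≠ 0 := right_ne_zero_of_mul (a := c) hi
  have hv (k : Fin m) : v k (i k) ≠ 0 := Finset.prod_ne_zero_iff.1 hprod k (Finset.mem_univ k)
  refine ⟨fun k l => (if k = 0 then (c • outer v) i else 1) * (v k l / v k (i k)), ?_, ?_, ?_⟩
  · simpa only [if_true, div_self (hv 0), mul_one] using hi
  · intro k hk
    simp only [if_neg hk, one_mul, div_self (hv k)]
  · ext q
    simp only [outer, Finset.prod_mul_distrib, Finset.prod_ite_eq', Finset.mem_univ, if_true,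
      Finset.prod_div_distrib, Pi.smul_apply, smul_eq_mul]
    field_simp

theorem outer_interpolate {X : Tensor K r} (hX : X ∈ elementaryTensors K r) {i : MultiIndex r}
    (hi : X i ≠ 0) : outer (interpolate i X) = X := by
  obtain ⟨a, ha₀, ha₁, rfl⟩ := exists_outer_eq_of_apply_ne_zero hX hi
  rw [interpolate_outer i a ha₀ ha₁]

end Interpolation

section Reindexing

variable {K : Type*} [Field K] {R R' m m' : ℕ} {r : Fin m → ℕ} {r' : Fin m' → ℕ}

theorem admissible_trans (τ : Fin R' ≃ Fin R) (ρ : Fin R ≃ MultiIndex r) :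
    admissible K (τ.trans ρ) = (· ∘ τ.symm) ⁻¹' admissible K ρ :=
  rfl

theorem comp_mem_admissible_trans_iff (τ : Fin R' ≃ Fin R) {ρ : Fin R ≃ MultiIndex r}
    {a : Fin R → K} : a ∘ τ ∈ admissible K (τ.trans ρ) ↔ a ∈ admissible K ρ := by
  rw [admissible_trans, Set.mem_preimage, Function.comp_assoc, Equiv.self_comp_symm,
    Function.comp_id]

theorem admissible_trans_ssubset_iff (τ : Fin R' ≃ Fin R) {ρ : Fin R ≃ MultiIndex r}
    {ρ' : Fin R ≃ MultiIndex r'} :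
    admissible K (τ.trans ρ) ⊂ admissible K (τ.trans ρ') ↔ admissible K ρ ⊂ admissible K ρ' := by
  have hsurj : Function.Surjective fun a : Fin R' → K => a ∘ τ.symm :=
    τ.symm.injective.surjective_comp_right
  rw [admissible_trans, admissible_trans, Set.ssubset_def, Set.ssubset_def,
    hsurj.preimage_subset_preimage_iff, hsurj.preimage_subset_preimage_iff]

theorem IsMaximalRankOnePerm.comp_equiv (τ : Fin R' ≃ Fin R) {ρ : Fin R ≃ MultiIndex r}
    {a : Fin R → K} (h : IsMaximalRankOnePerm ρ a) :
    IsMaximalRankOnePerm (τ.trans ρ) (a ∘ τ) := by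
  refine ⟨(comp_mem_admissible_trans_iff τ).2 h.1, fun m' r' hr' ρ' hlt ha => ?_⟩
  obtain ⟨ρ', rfl⟩ : ∃ ρ'' : Fin R ≃ MultiIndex r', τ.trans ρ'' = ρ' :=
    ⟨τ.symm.trans ρ', by ext; simp⟩
  exact h.2 m' r' hr' ρ' ((admissible_trans_ssubset_iff τ).1 hlt)
    ((comp_mem_admissible_trans_iff τ).1 ha)

theorem HasUniqueMaximalRankOnePerm.comp_equiv (τ : Fin R' ≃ Fin R) {a : Fin R → K}
    (h : HasUniqueMaximalRankOnePerm r a) : HasUniqueMaximalRankOnePerm r (a ∘ τ) := by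
  obtain ⟨ρ, hρ, huniq⟩ := h
  refine ⟨τ.trans ρ, hρ.comp_equiv τ, fun m' r' hr' ρ' hρ' => ?_⟩
  have hmax : IsMaximalRankOnePerm (τ.symm.trans ρ') a := by
    simpa only [Function.comp_assoc, Equiv.self_comp_symm, Function.comp_id] using
      hρ'.comp_equiv τ.symm
  exact huniq m' r' hr' _ hmax

end Reindexing

section MaximalPermutations

variable {K : Type*} [Field K] {R m m' : ℕ} {r : Fin m → ℕ} {r' : Fin m' → ℕ}

theorem finite_shapes_prod_eq (R : ℕ) :
    {x : Σ m, Fin m → ℕ | (∀ k, 2 ≤ x.2 k) ∧ ∏ k, x.2 k = R}.Finite := by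
  refine ((Finset.Iic R).sigma fun m => Finset.Iic fun _ : Fin m => R).finite_toSet.subset ?_
  rintro ⟨m, r⟩ ⟨hr, rfl⟩
  have hm : m ≤ ∏ k, r k :=
    calc
      m ≤ 2 ^ m := Nat.lt_two_pow_self.le
      _ ≤ ∏ k, r k := by simpa using Finset.pow_card_le_prod Finset.univ r 2 fun k _ => hr k
  have hrk (k : Fin m) : r k ≤ ∏ k, r k :=
    Finset.single_le_prod' (fun k _ => one_le_two.trans (hr k)) (Finset.mem_univ k)
  simpa [Pi.le_def] using ⟨hm, hrk⟩

theorem finite_setOf_admissible (K : Type*) [Field K] (R : ℕ) :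
    {S : Set (Fin R → K) | ∃ (m : ℕ) (r : Fin m → ℕ) (ρ : Fin R ≃ MultiIndex r),
      (∀ k, 2 ≤ r k) ∧ admissible K ρ = S}.Finite := by
  refine ((finite_shapes_prod_eq R).biUnion fun x _ =>
    Set.finite_range fun ρ : Fin R ≃ MultiIndex x.2 => admissible K ρ).subset ?_
  rintro S ⟨m, r, ρ, hr, hS⟩
  have hR : ∏ k, r k = R := by simpa using (Fintype.card_congr ρ).symm
  exact Set.mem_biUnion (x := ⟨m, r⟩) ⟨hr, hR⟩ ⟨ρ, hS⟩

theorem exists_isMaximalRankOnePerm_admissible_subset (hr : ∀ k, 2 ≤ r k)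
    {ρ : Fin R ≃ MultiIndex r} {a : Fin R → K} (ha : a ∈ admissible K ρ) :
    ∃ (m' : ℕ) (r' : Fin m' → ℕ) (ρ' : Fin R ≃ MultiIndex r'), (∀ k, 2 ≤ r' k) ∧
      IsMaximalRankOnePerm ρ' a ∧ admissible K ρ' ⊆ admissible K ρ := by
  obtain ⟨_, hsub, ⟨⟨m', r', ρ', hr', rfl⟩, ha'⟩, hmin⟩ :=
    ((finite_setOf_admissible K R).sep (a ∈ ·)).exists_le_minimal ⟨⟨m, r, ρ, hr, rfl⟩, ha⟩
  refine ⟨m', r', ρ', hr', ⟨ha', fun m'' r'' hr'' ρ'' hlt ha'' => ?_⟩, hsub⟩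
  exact hlt.2 (hmin ⟨⟨m'', r'', ρ'', hr'', rfl⟩, ha''⟩ hlt.1)

theorem isRankOnePreserver_symm_trans_iff {ρ : Fin R ≃ MultiIndex r}
    {ρ' : Fin R ≃ MultiIndex r'} :
    IsRankOnePreserver K (ρ.symm.trans ρ') ↔ admissible K ρ ⊆ admissible K ρ' := by
  constructor
  · intro h a ha
    simpa [admissible] using h _ ha
  · intro h X hX
    have hXρ : X ∘ ρ ∈ admissible K ρ := by simpa [admissible] using hX
    exact h hXρ

/-- The rank-one preserver permutations of `[r]`, as a submonoid of the group of permutations. -/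
def rankOnePreservers (K : Type*) [Field K] {m : ℕ} (r : Fin m → ℕ) :
    Submonoid (Equiv.Perm (MultiIndex r)) where
  carrier := {σ | IsRankOnePreserver K σ}
  one_mem' := fun _ hX => hX
  mul_mem' := fun hσ hτ X hX => hσ _ (hτ X hX)

-- A submonoid of a finite group is closed under inverses.
theorem IsRankOnePreserver.symm {σ : Equiv.Perm (MultiIndex r)} (h : IsRankOnePreserver K σ) :
    IsRankOnePreserver K σ.symm :=
  (Submonoid.powers_le (P := rankOnePreservers K r)).2 h
    (mem_powers_iff_mem_zpowers.2 (inv_mem (Subgroup.mem_zpowers σ)))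

theorem admissible_eq_of_subset {ρ ρ' : Fin R ≃ MultiIndex r}
    (h : admissible K ρ ⊆ admissible K ρ') : admissible K ρ = admissible K ρ' :=
  h.antisymm (isRankOnePreserver_symm_trans_iff.1 (isRankOnePreserver_symm_trans_iff.2 h).symm)

theorem HasUniqueMaximalRankOnePerm.admissible_eq {a : Fin R → K}
    (h : HasUniqueMaximalRankOnePerm r a) (hr : ∀ k, 2 ≤ r k) {ρ ρ' : Fin R ≃ MultiIndex r}
    (hρ : a ∈ admissible K ρ) (hρ' : a ∈ admissible K ρ') :
    admissible K ρ = admissible K ρ' := by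
  obtain ⟨ρ₀, -, huniq⟩ := h
  have eq_unique (ρ : Fin R ≃ MultiIndex r) (hρ : a ∈ admissible K ρ) :
      admissible K ρ₀ = admissible K ρ := by
    obtain ⟨m₁, r₁, ρ₁, hr₁, hmax, hsub⟩ := exists_isMaximalRankOnePerm_admissible_subset hr hρ
    have hpres := huniq m₁ r₁ hr₁ ρ₁ hmax
    exact admissible_eq_of_subset ((isRankOnePreserver_symm_trans_iff.1 hpres).trans hsub)
  exact (eq_unique ρ hρ).symm.trans (eq_unique ρ' hρ')

end MaximalPermutations

section HadamardHitchcock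

variable {K : Type*} [Field K] {d m R : ℕ} {n : Fin d → ℕ} {r : Fin m → ℕ} {T : Tensor K n}
  {A : ∀ k, Fin (r k) → Tensor K n} {ρ : Fin R ≃ MultiIndex r} {B : Fin R → Tensor K n}

theorem IsHHDIdentifiable.exists_isHHD (h : IsHHDIdentifiable r T) :
    ∃ A : ∀ k, Fin (r k) → Tensor K n, IsHHD T A := by
  obtain ⟨E, -⟩ := h
  obtain ⟨⟨A, hA⟩, -⟩ := Quotient.exists_rep E
  exact ⟨A, hA⟩

theorem IsHHDIdentifiable.eq_mk (h : IsHHDIdentifiable r T) (hA : IsHHD T A)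
    (E : EssentialHHD r T) : E = EssentialHHD.mk A hA := by
  obtain ⟨E₀, hE₀⟩ := h
  exact (hE₀ E).trans (hE₀ _).symm

theorem prod_sum_eq_sum_hht (A : ∀ k, Fin (r k) → Tensor K n) :
    ∏ k, ∑ i, A k i = ∑ q, hht A q := by
  simp only [Finset.prod_univ_sum, Fintype.piFinset_univ, hht]

theorem hht_apply (A : ∀ k, Fin (r k) → Tensor K n) (q : MultiIndex r) (j : MultiIndex n) :
    hht A q j = outer (fun k l => A k l j) q :=
  Finset.prod_apply j Finset.univ fun k => A k (q k)

theorem IsHHD.hht_mem_elementaryTensors (hA : IsHHD T A) (q : MultiIndex r) :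
    hht A q ∈ elementaryTensors K n :=
  Submonoid.prod_mem _ fun k _ => (hA.1 k (q k)).2

theorem IsHHD.isHitchcock_hht_comp (hA : IsHHD T A) (hrank : tensorRank T = R)
    (e : Fin R ≃ MultiIndex r) : IsHitchcock T (hht A ∘ e) := by
  have hsum : T = ∑ q, hht A q := hA.2.trans (prod_sum_eq_sum_hht A)
  have hcard : Fintype.card (MultiIndex r) = R := by simpa using (Fintype.card_congr e).symm
  have hrank_sum : Fintype.card (MultiIndex r) ≤ tensorRank (∑ q, hht A q) := by
    rw [← hsum, hrank, hcard]
  exact ⟨fun s => isRankOne_of_card_le_tensorRank_sum hA.hht_mem_elementaryTensors hrank_sum (e s),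
    hsum.trans (Equiv.sum_comp e (hht A)).symm⟩

theorem IsHHD.exists_stack_eq_hht (hA : IsHHD T A) (hT : IsIdentifiable (∏ k, r k) T)
    {B : Fin (∏ k, r k) → Tensor K n} (hB : IsHitchcock T B) :
    ∃ ρ : Fin (∏ k, r k) ≃ MultiIndex r, stack ρ B = hht A := by
  have hH := hA.isHitchcock_hht_comp hT.1 finPiFinEquiv.symm
  obtain ⟨τ, rfl⟩ := hT.exists_perm_eq_comp hB hH
  exact ⟨τ.trans finPiFinEquiv.symm, by ext; simp [stack]⟩

theorem entryVector_mem_admissible_of_stack_eq_hht (h : stack ρ B = hht A) {s : Fin R}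
    {j : MultiIndex n} (hs : B s j ≠ 0) : entryVector B j ∈ admissible K ρ := by
  refine ⟨Function.ne_iff.2 ⟨ρ s, by simpa [entryVector] using hs⟩, 1, fun k l => A k l j, ?_⟩
  ext q
  rw [one_smul, ← hht_apply, ← h]
  rfl

variable [NeZero m] {i : MultiIndex r}

theorem hht_decouple (hi : ∀ j, stack ρ B i j ≠ 0)
    (hrank : ∀ j, entryVector B j ∈ admissible K ρ) : hht (decouple ρ B i) = stack ρ B := by
  ext q j
  rw [hht_apply]
  exact congrFun (outer_interpolate (hrank j).2 (hi j)) q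

theorem decouple_eq_ite (ρ : Fin R ≃ MultiIndex r) (B : Fin R → Tensor K n) (i : MultiIndex r)
    (k : Fin m) (l : Fin (r k)) :
    decouple ρ B i k l = if k = 0 then stack ρ B (Function.update i k l)
      else stack ρ B (Function.update i k l) / stack ρ B i := by
  ext j
  rw [decouple, interpolate]
  split_ifs <;> rfl

theorem isRankOne_decouple (hB : ∀ s, IsRankOne (B s)) (hi : IsRankOneUnit (stack ρ B i))
    (k : Fin m) (l : Fin (r k)) : IsRankOne (decouple ρ B i k l) := by
  rw [decouple_eq_ite]
  split_ifs
  · exact hB _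
  · exact (hB _).div hi

theorem isHHD_decouple (hB : IsHitchcock T B) (hi : IsRankOneUnit (stack ρ B i))
    (hht_eq : hht (decouple ρ B i) = stack ρ B) : IsHHD T (decouple ρ B i) := by
  refine ⟨isRankOne_decouple hB.1 hi, ?_⟩
  calc
    T = ∑ s, B s := hB.2
    _ = ∑ q, stack ρ B q := (Equiv.sum_comp ρ.symm B).symm
    _ = ∏ k, ∑ l, decouple ρ B i k l := by rw [prod_sum_eq_sum_hht, hht_eq]

end HadamardHitchcock

theorem mainTheorem8_general {K : Type*} [Field K] {d m : ℕ} [NeZero m]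
    (n : Fin d → ℕ) (r : Fin m → ℕ) (hr : ∀ k, 2 ≤ r k) (T : Tensor K n)
    (hT : IsHHDIdentifiable r T)
    (hTR : IsIdentifiable (∏ k, r k) T)
    (C : Fin (∏ k, r k) → Tensor K n) (hC : IsCPD T C)
    (hunit : ∃ s, IsRankOneUnit (C s))
    (p : MultiIndex n)
    (huniq : HasUniqueMaximalRankOnePerm r (entryVector C p)) :
    ∀ B : Fin (∏ k, r k) → Tensor K n, IsCPD T B →
      (∃ ρ : Fin (∏ k, r k) ≃ MultiIndex r, IsMaximalRankOnePerm ρ (entryVector B p)) ∧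
      ∀ ρ : Fin (∏ k, r k) ≃ MultiIndex r, IsMaximalRankOnePerm ρ (entryVector B p) →
        (∃ i : MultiIndex r, IsRankOneUnit (stack ρ B i)) ∧
        ∀ i : MultiIndex r, IsRankOneUnit (stack ρ B i) →
          hht (decouple ρ B i) = stack ρ B ∧
          ∃ h : IsHHD T (decouple ρ B i),
            ∀ E : EssentialHHD r T, E = EssentialHHD.mk (decouple ρ B i) h := by
  intro B hB
  obtain ⟨τ, hτ⟩ := hTR.exists_perm_eq_comp hB.2 hC.2
  have huniqB : HasUniqueMaximalRankOnePerm r (entryVector B p) := hτ ▸ huniq.comp_equiv τ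
  obtain ⟨s, hs⟩ : ∃ s, IsRankOneUnit (B s) :=
    hτ ▸ hunit.imp' τ.symm fun s hs => by simpa using hs
  obtain ⟨A, hA⟩ := hT.exists_isHHD
  obtain ⟨ρ₀, hρ₀⟩ := hA.exists_stack_eq_hht hTR hB.2
  have rankOne_slice₀ (j : MultiIndex n) : entryVector B j ∈ admissible K ρ₀ :=
    entryVector_mem_admissible_of_stack_eq_hht hρ₀ (hs.1 j)
  refine ⟨huniqB.imp fun _ h => h.1, fun ρ hρ => ⟨⟨ρ s, by simpa [stack] using hs⟩,
    fun i hi => ?_⟩⟩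
  have admissible_eq : admissible K ρ₀ = admissible K ρ :=
    huniqB.admissible_eq hr (rankOne_slice₀ p) hρ.1
  have hht_eq : hht (decouple ρ B i) = stack ρ B :=
    hht_decouple hi.1 fun j => admissible_eq ▸ rankOne_slice₀ j
  have hHHD : IsHHD T (decouple ρ B i) := isHHD_decouple hB.2 hi hht_eq
  exact ⟨hht_eq, hHHD, hT.eq_mk hHHD⟩

theorem mainTheorem8 {K : Type*} [Field K] [CharZero K] {d m : ℕ} [NeZero m]
    (n : Fin d → ℕ) (r : Fin m → ℕ) (hr : ∀ k, 2 ≤ r k) (T : Tensor K n)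
    (hT : IsHHDIdentifiable r T)
    (hTR : IsIdentifiable (∏ k, r k) T)
    (C : Fin (∏ k, r k) → Tensor K n) (hC : IsCPD T C)
    (hunit : ∃ s, IsRankOneUnit (C s))
    (p : MultiIndex n)
    (hinj : Function.Injective (entryVector C p))
    (huniq : HasUniqueMaximalRankOnePerm r (entryVector C p)) :
    -- step 1: `B` is the computed CPD
    ∀ B : Fin (∏ k, r k) → Tensor K n, IsCPD T B →
      -- step 2: `ρ` is the computed rank-1 permutation
      (∃ ρ : Fin (∏ k, r k) ≃ MultiIndex r, IsMaximalRankOnePerm ρ (entryVector B p)) ∧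
      ∀ ρ : Fin (∏ k, r k) ≃ MultiIndex r, IsMaximalRankOnePerm ρ (entryVector B p) →
        -- steps 3 and 4: stack the terms, and extract at a base index `i`
        (∃ i : MultiIndex r, IsRankOneUnit (stack ρ B i)) ∧
        ∀ i : MultiIndex r, IsRankOneUnit (stack ρ B i) →
          hht (decouple ρ B i) = stack ρ B ∧
          ∃ h : IsHHD T (decouple ρ B i),
            ∀ E : EssentialHHD r T, E = EssentialHHD.mk (decouple ρ B i) h :=
  mainTheorem8_general n r hr T hT hTR C hC hunit p huniq
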